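/- There is a universal constant $C>0$ such that the following holds. Let $\mathcal S$ and $\mathcal A$ be finite sets with $S=|\mathcal S|$ and $A=|\mathcal A|$, and let $\mathcal B$ be a set of $B\ge 2$ functions (deterministic policies) $h:\mathcal S\to\mathcal A$. Let $\mathcal X\subseteq\mathcal S$, with $X=|\mathcal X|$, be a separator set for $\mathcal B$: any two distinct $h,h'\in\mathcal B$ satisfy $h(x)\neq h'(x)$ for some $x\in\mathcal X$. Let $\mathcal O$ be a cost-sensitive classification oracle for $\mathcal B$: on every finite multiset $D$ of examples $(x,\vec c)\in\mathcal S\times\mathbb R^{\mathcal A}$ it returns an $h\in\mathcal B$ minimizing the average $\mathbb E_{(x,\vec c)\sim D}[\vec c(h(x))]$. Let $N,K\ge 1$ be integers, $\mu>0$ and $\delta\in(0,1]$, and put $$\eta=\frac{1}{\mu\sqrt{NA}}\Big(\frac{\ln B}{X}\Big)^{1/4},\qquad T=\Big\lceil \frac{N\ln(2NS/\delta)}{\sqrt{X^3\ln B}}\Big\rceil .$$ For rounds $n=1,\dots,N$, let $D_n$ be a random data set of $K$ examples, all of whose costs lie in $[-\mu,\mu]$. The data sets may be generated adaptively: $D_n$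 may depend in any way on the past and on the learner's output $u_n$. Let $g_n=\big(\mathbb E_{(x,\vec c)\sim D_n}[\vec c(h(x))]\big)_{h\in\mathcal B}$ be the loss vector induced by $D_n$. In round $n$, the algorithm MFTPL draws independent standard Gaussian vectors $\ell^{(n)}_{x,j}\sim\mathcal N(0,I_A)$, $x\in\mathcal X$, $1\le j\le T$, independently of the earlier data sets $(D_1,\dots,D_{n-1})$. It calls the oracle $T$ times, $$h_{n,j}=\mathcal O\Big(D_1\cup\dots\cup D_{n-1}\cup\big\{(x,\tfrac K\eta\,\ell^{(n)}_{x,j}):x\in\mathcal X\big\}\Big)$$ (a union of multisets), and outputs $u_n=\frac1T\sum_{j=1}^T e_{h_{n,j}}\in\Delta(\mathcal B)$, where $e_h$ is the one-hot vector of $h$ and $\Delta(\mathcal B)$ is the set of probability vectors on $\mathcal B$. Then, with probability at least $1-\delta$, $$\mathrm{LReg}_N:=\sum_{n=1}^N\langle g_n,u_n\rangle-\min_{u\in\Delta(\mathcal B)}\sum_{n=1}^N\langle g_n,u\rangle\;\le\; C\,\mu\sqrt{NA}\,\big(X^3\ln B\big)^{1/4}.$$ -/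

import Mathlib

open MeasureTheory ProbabilityTheory

noncomputable section

/-- A cost-sensitive classification example `(x, c)`: a state and one cost per action. -/
abbrev CSCExample (S A : Type*) := S × (A → ℝ)

/-- The multiset of the `K` examples of a data set. -/
def toExamples {S A : Type*} {K : ℕ} (D : Fin K → CSCExample S A) :
    Multiset (CSCExample S A) :=
  Finset.univ.val.map D

/-- The empirical cost of the policy `h` on a multiset of examples, that is, the average of
`c (h x)` over the examples `(x, c)`. -/
def empCost {S A : Type*} (D : Multiset (CSCExample S A)) (h : S → A) : ℝ :=
  (D.map fun e => e.2 (h e.1)).sum / (Multiset.card D : ℝ)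

/-- `O` is a cost-sensitive classification oracle for the policy class `𝓑`: on every multiset of
examples it returns a policy of `𝓑` with the smallest empirical cost. -/
def IsCSCOracle {S A : Type*} {𝓑 : Finset (S → A)}
    (O : Multiset (CSCExample S A) → 𝓑) : Prop :=
  ∀ (D : Multiset (CSCExample S A)) (h : 𝓑), empCost D (O D).1 ≤ empCost D h.1

/-- `𝓧` is a separator set for `𝓑`: any two distinct policies of `𝓑` differ on `𝓧`. -/
def IsSeparator {S A : Type*} (𝓧 : Finset S) (𝓑 : Finset (S → A)) : Prop :=
  ∀ h ∈ 𝓑, ∀ h' ∈ 𝓑, h ≠ h' → ∃ x ∈ 𝓧, h x ≠ h' x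

/-- The loss vector `g` in `ℝ^𝓑` induced by a multiset of examples. -/
def lossVector {S A : Type*} (𝓑 : Finset (S → A)) (D : Multiset (CSCExample S A)) : 𝓑 → ℝ :=
  fun h => empCost D h.1

open Classical in
/-- The one-hot vector of `w`. -/
def oneHot {W : Type*} (w : W) : W → ℝ := Pi.single w 1

/-- The perturbation examples `(x, r • ℓ x)`, one for each `x` of the separator set. -/
def perturbationSet {S A : Type*} (𝓧 : Finset S) (r : ℝ) (ℓ : 𝓧 → A → ℝ) :
    Multiset (CSCExample S A) :=
  Finset.univ.val.map fun x : 𝓧 => (x.1, r • ℓ x)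

/-- The output of one call of the algorithm: given the accumulated examples `past` (data sets of
size `K` each), the learning rate `η`, the sparsification parameter `T` and the `T` draws `ℓ j` of
the perturbation, it is the average of the one-hot vectors of the policies that the oracle returns
on `past` together with the perturbation set of the `j`-th draw, scaled by `K / η`. -/
def mftpl {S A : Type*} {𝓑 : Finset (S → A)} (O : Multiset (CSCExample S A) → 𝓑)
    (past : Multiset (CSCExample S A)) (𝓧 : Finset S) (K : ℕ) (η : ℝ) (T : ℕ)
    (ℓ : Fin T → 𝓧 → A → ℝ) : 𝓑 → ℝ :=
  (T : ℝ)⁻¹ • ∑ j : Fin T, oneHot (O (past + perturbationSet 𝓧 ((K : ℝ) / η) (ℓ j)))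

/-- The output of the algorithm at round `n`, whose accumulated examples are the data sets of the
earlier rounds. -/
def mftplRound {S A : Type*} {𝓑 : Finset (S → A)} {K N T : ℕ}
    (O : Multiset (CSCExample S A) → 𝓑) (𝓧 : Finset S) (η : ℝ)
    (D : Fin N → Fin K → CSCExample S A) (n : Fin N) (ℓ : Fin T → 𝓧 → A → ℝ) : 𝓑 → ℝ :=
  mftpl O (∑ i ∈ Finset.Iio n, toExamples (D i)) 𝓧 K η T ℓ

/-- The law of the draws of one call: `T * |𝓧| * |A|` independent standard normal variables. -/
def perturbationLaw {S : Type*} (A : Type*) [Fintype A] (𝓧 : Finset S) (T : ℕ) :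
    Measure (Fin T → 𝓧 → A → ℝ) :=
  Measure.pi fun _ => Measure.pi fun _ => Measure.pi fun _ => gaussianReal 0 1

/-- The regret of `u` on the linear losses `g`, against the best fixed point of the simplex. -/
def linearRegret {W : Type*} [Fintype W] {N : ℕ} (g u : Fin N → W → ℝ) : ℝ :=
  ∑ n, g n ⬝ᵥ u n - ⨅ v : stdSimplex ℝ W, ∑ n, g n ⬝ᵥ v.1

end

/-!
In each round the algorithm plays the empirical law of `T` independent perturbed leaders, so its
regret splits into the regret of the exact law of the perturbed leader and a sampling error.

*Exact law.* The oracle minimizes the cumulative loss `G h` plus `1 / η` times `noise h`, the sum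
over `x` in the separator set of the Gaussian `ℓ x (h x)`. Let `leaderPotential G` be the expected
minimum. Being concave in `G`, it grows in each round by at least what the leader of the *next*
round would pay (`leaderPotential_add_le`); it ends below the loss of every fixed mixture and starts
above `-O(√(X log B)) / η` (`neg_le_leaderPotential_zero`). What remains is the stability of the
leader (`sum_mul_leaderProb_sub_le`). As every competitor of `h` differs from `h` on the separator
set, translating the noise by `-t` at all entries `(x, h x)` favours `h` over each competitor by at
least `t / η`. With `t = 2 η μ` this outweighs one loss vector, so by the Cameron–Martin formula
the probability of `h` drops by at most the integral of `t ^ 2 X / 2 + t |noise h|` over the event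
that `h` leads. These events are disjoint, and `|noise h|` is at most the sum of all `|ℓ x a|`, of
expectation at most `X A`. Hence each round costs `O(η μ ^ 2 X A)`.

*Sampling error.* The draws of a round are independent of the cumulative losses, so conditionally
on these the `T` leaders are independent with the exact law; this holds also if the oracle is not
measurable, as ties have probability zero (`ae_noTies`). The current loss vector may depend on the
draws, but it is an average of cost vectors in `[-μ, μ] ^ A` read off at single states. It is
therefore enough to control the `S 2 ^ A` functions that apply a sign to the action at a state,
which Hoeffding's inequality and a union bound do.
-/

/-! ### Translation of Gaussian matrices -/

section GaussianMatrix

theorem gaussianReal_eq_withDensity_exp (v : ℝ) :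
    gaussianReal v 1 =
      (gaussianReal 0 1).withDensity fun x => ENNReal.ofReal (Real.exp (v * x - v ^ 2 / 2)) := by
  rw [gaussianReal_of_var_ne_zero _ one_ne_zero, gaussianReal_of_var_ne_zero _ one_ne_zero,
    ← withDensity_mul _ (measurable_gaussianPDF _ _) (by fun_prop)]
  congr 1
  ext x
  simp only [Pi.mul_apply, gaussianPDF, gaussianPDFReal]
  rw [← ENNReal.ofReal_mul (by positivity), mul_assoc _ (Real.exp _), ← Real.exp_add]
  congr 3
  simp
  ring

theorem measure_pi_withDensity {ι : Type*} [Fintype ι] {α : ι → Type*} [∀ i, MeasurableSpace (α i)]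
    (μ : ∀ i, Measure (α i)) [∀ i, IsProbabilityMeasure (μ i)] (f : ∀ i, α i → ENNReal)
    (hf : ∀ i, Measurable (f i)) [∀ i, SigmaFinite ((μ i).withDensity (f i))] :
    Measure.pi (fun i => (μ i).withDensity (f i)) =
      (Measure.pi μ).withDensity fun x => ∏ i, f i (x i) := by
  refine Measure.pi_eq fun s hs => ?_
  have hind : iIndepFun (fun i (x : ∀ i, α i) => (s i).indicator (f i) (x i)) (Measure.pi μ) :=
    iIndepFun_pi fun i => ((hf i).indicator (hs i)).aemeasurable
  rw [withDensity_apply _ (MeasurableSet.univ_pi hs),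
    ← lintegral_indicator (MeasurableSet.univ_pi hs)]
  have h1 : ∀ x : ∀ i, α i, (Set.univ.pi s).indicator (fun x => ∏ i, f i (x i)) x =
      ∏ i, (s i).indicator (f i) (x i) := by
    intro x
    by_cases hx : x ∈ Set.univ.pi s
    · rw [Set.indicator_of_mem hx]
      exact Finset.prod_congr rfl fun i _ => (Set.indicator_of_mem (hx i trivial) _).symm
    · rw [Set.indicator_of_notMem hx]
      obtain ⟨i, hi⟩ : ∃ i, x i ∉ s i := by simpa [Set.mem_pi] using hx
      exact (Finset.prod_eq_zero (Finset.mem_univ i) (Set.indicator_of_notMem hi _)).symm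
  simp_rw [h1]
  rw [lintegral_prod_eq_prod_lintegral_of_indepFun _ _ hind
    fun i => ((hf i).indicator (hs i)).comp (measurable_pi_apply i)]
  refine Finset.prod_congr rfl fun i _ => ?_
  rw [withDensity_apply _ (hs i), ← lintegral_indicator (hs i),
    ← (measurePreserving_eval μ i).lintegral_comp ((hf i).indicator (hs i))]

/-- The law of a matrix of independent standard normal variables. -/
noncomputable def gaussianMatrix (X A : Type*) [Fintype X] [Fintype A] : Measure (X → A → ℝ) :=
  Measure.pi fun _ => Measure.pi fun _ => gaussianReal 0 1

instance (X A : Type*) [Fintype X] [Fintype A] : IsProbabilityMeasure (gaussianMatrix X A) := by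
  unfold gaussianMatrix; infer_instance

variable {X A : Type*} [Fintype X] [Fintype A]

/-- The Cameron–Martin formula for a standard Gaussian matrix. -/
theorem gaussianMatrix_map_add (v : X → A → ℝ) :
    (gaussianMatrix X A).map (fun ℓ => ℓ + v) =
      (gaussianMatrix X A).withDensity fun ℓ =>
        ENNReal.ofReal (Real.exp (∑ x, ∑ a, (v x a * ℓ x a - v x a ^ 2 / 2))) := by
  have h1 : (gaussianMatrix X A).map (fun ℓ => ℓ + v) =
      Measure.pi fun x => Measure.pi fun a => gaussianReal (v x a) 1 := by
    have hrow (x : X) : (Measure.pi fun _ : A => gaussianReal 0 1).map (fun ℓ => ℓ + v x) =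
        Measure.pi fun a => gaussianReal (v x a) 1 := by
      have := Measure.pi_map_pi (μ := fun _ : A => gaussianReal 0 1)
        (f := fun a y => y + v x a) (hμ := ?_) (fun a => by fun_prop)
      · simp only [gaussianReal_map_add_const, zero_add] at this
        exact this
      · intro a
        rw [gaussianReal_map_add_const]
        infer_instance
    have := Measure.pi_map_pi (μ := fun _ : X => Measure.pi fun _ : A => gaussianReal 0 1)
        (f := fun x y => y + v x) (hμ := ?_) (fun a => by fun_prop)
    · simp only [hrow] at this
      exact this
    · intro x
      rw [hrow]
      infer_instance
  have hrow (x : X) : (Measure.pi fun a => gaussianReal (v x a) 1) =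
      (Measure.pi fun _ : A => gaussianReal 0 1).withDensity
        fun ℓ => ∏ a, ENNReal.ofReal (Real.exp (v x a * ℓ a - v x a ^ 2 / 2)) := by
    have (a : A) : SigmaFinite ((gaussianReal 0 1).withDensity
        fun y => ENNReal.ofReal (Real.exp (v x a * y - v x a ^ 2 / 2))) := by
      rw [← gaussianReal_eq_withDensity_exp]; infer_instance
    rw [← measure_pi_withDensity (fun _ : A => gaussianReal 0 1)
      (fun a y => ENNReal.ofReal (Real.exp (v x a * y - v x a ^ 2 / 2))) (fun a => by fun_prop)]
    simp_rw [← gaussianReal_eq_withDensity_exp]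
  have (x : X) : SigmaFinite ((Measure.pi fun _ : A => gaussianReal 0 1).withDensity
        fun ℓ => ∏ a, ENNReal.ofReal (Real.exp (v x a * ℓ a - v x a ^ 2 / 2))) := by
    rw [← hrow]; infer_instance
  rw [h1]
  simp_rw [hrow]
  rw [measure_pi_withDensity _ _ (fun x => by fun_prop)]
  unfold gaussianMatrix
  congr 1
  ext ℓ
  simp_rw [Real.exp_sum]
  rw [ENNReal.ofReal_prod_of_nonneg fun _ _ => by positivity]
  refine Finset.prod_congr rfl fun x _ => ?_
  rw [ENNReal.ofReal_prod_of_nonneg fun _ _ => by positivity]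

theorem integral_gaussianMatrix_comp_add (v : X → A → ℝ) {f : (X → A → ℝ) → ℝ}
    (hf : Measurable f) :
    ∫ ℓ, f (ℓ + v) ∂gaussianMatrix X A =
      ∫ ℓ, Real.exp (∑ x, ∑ a, (v x a * ℓ x a - v x a ^ 2 / 2)) * f ℓ ∂gaussianMatrix X A := by
  rw [← integral_map (φ := fun ℓ => ℓ + v) (by fun_prop) hf.aestronglyMeasurable,
    gaussianMatrix_map_add, integral_withDensity_eq_integral_toReal_smul (by fun_prop) (by simp)]
  refine integral_congr_ae (.of_forall fun ℓ => ?_)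
  simp [ENNReal.toReal_ofReal (Real.exp_nonneg _)]

theorem integrable_exp_gaussianMatrix (v : X → A → ℝ) :
    Integrable (fun ℓ => Real.exp (∑ x, ∑ a, (v x a * ℓ x a - v x a ^ 2 / 2)))
      (gaussianMatrix X A) := by
  refine ⟨Measurable.aestronglyMeasurable (by fun_prop), ?_⟩
  rw [hasFiniteIntegral_iff_ofReal (.of_forall fun _ => Real.exp_nonneg _),
    ← setLIntegral_univ, ← withDensity_apply _ .univ, ← gaussianMatrix_map_add]
  exact measure_lt_top _ _

theorem integral_exp_gaussianMatrix (v : X → A → ℝ) :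
    ∫ ℓ, Real.exp (∑ x, ∑ a, (v x a * ℓ x a - v x a ^ 2 / 2)) ∂gaussianMatrix X A = 1 := by
  simpa using (integral_gaussianMatrix_comp_add v (f := fun _ => 1) measurable_const).symm

theorem measurePreserving_gaussianMatrix_entry (x : X) (a : A) :
    MeasurePreserving (fun ℓ => ℓ x a) (gaussianMatrix X A) (gaussianReal 0 1) :=
  (measurePreserving_eval (fun _ : A => gaussianReal 0 1) a).comp
    (measurePreserving_eval (fun _ : X => Measure.pi fun _ : A => gaussianReal 0 1) x)

theorem integrable_gaussianMatrix_entry (x : X) (a : A) :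
    Integrable (fun ℓ => ℓ x a) (gaussianMatrix X A) :=
  (measurePreserving_gaussianMatrix_entry x a).integrable_comp_of_integrable
    (g := id) ((memLp_id_gaussianReal 1).integrable (by simp))

theorem integral_gaussianMatrix_entry (x : X) (a : A) :
    ∫ ℓ, ℓ x a ∂gaussianMatrix X A = 0 := by
  have h := (measurePreserving_gaussianMatrix_entry x a).map_eq
  rw [← integral_map (φ := fun ℓ : X → A → ℝ => ℓ x a) (f := fun y => y)
    (measurePreserving_gaussianMatrix_entry x a).aemeasurable (by fun_prop), h,
    integral_id_gaussianReal]

theorem integral_abs_gaussianMatrix_entry_le (x : X) (a : A) :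
    ∫ ℓ, |ℓ x a| ∂gaussianMatrix X A ≤ 1 := by
  have h := (measurePreserving_gaussianMatrix_entry x a).map_eq
  rw [← integral_map (φ := fun ℓ : X → A → ℝ => ℓ x a) (f := fun y => |y|)
    (measurePreserving_gaussianMatrix_entry x a).aemeasurable (by fun_prop), h]
  have hL := memLp_id_gaussianReal (μ := 0) (v := 1) 2
  have hsq : ∫ y, y ^ 2 ∂gaussianReal 0 1 = 1 := by
    have := variance_eq_sub (μ := gaussianReal 0 1) hL
    rw [variance_id_gaussianReal] at this
    simpa [integral_id_gaussianReal] using this.symm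
  have hi2 : Integrable (fun y => y ^ 2) (gaussianReal 0 1) := hL.integrable_sq
  calc ∫ y, |y| ∂gaussianReal 0 1 ≤ ∫ y, (1 + y ^ 2) / 2 ∂gaussianReal 0 1 := by
        refine integral_mono_of_nonneg (.of_forall fun _ => abs_nonneg _) (by fun_prop)
          (.of_forall fun y => ?_)
        nlinarith [sq_nonneg (|y| - 1), sq_abs y]
    _ = 1 := by
        rw [integral_div, integral_add (integrable_const _) hi2, hsq]
        norm_num

end GaussianMatrix

/-! ### The perturbed leader -/

section Leader

variable {W X A : Type*} [Fintype X]

/-- The perturbation that the noise matrix `ℓ` adds to the loss of `h`, where `pol h` is the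
policy that `h` stands for. -/
def noise (pol : W → X → A) (ℓ : X → A → ℝ) (h : W) : ℝ :=
  ∑ x, ℓ x (pol h x)

/-- The perturbed cumulative loss of `h`, for cumulative losses `G` and noise level `r`. -/
def perturbedLoss (pol : W → X → A) (r : ℝ) (G : W → ℝ) (ℓ : X → A → ℝ) (h : W) : ℝ :=
  G h + r * noise pol ℓ h

open Classical in
/-- The indicator that `h` is the strict minimizer of the perturbed loss. It vanishes identically
when the minimizer is not unique, which makes it a measurable function of `(G, ℓ)`. -/
noncomputable def leader (pol : W → X → A) (r : ℝ) (G : W → ℝ) (ℓ : X → A → ℝ) (h : W) : ℝ :=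
  if ∀ h', h' ≠ h → perturbedLoss pol r G ℓ h < perturbedLoss pol r G ℓ h' then 1 else 0

variable {pol : W → X → A} {r : ℝ} {G : W → ℝ} {ℓ : X → A → ℝ}

theorem leader_nonneg (h : W) : 0 ≤ leader pol r G ℓ h := by
  unfold leader; split_ifs <;> norm_num

theorem leader_le_one (h : W) : leader pol r G ℓ h ≤ 1 := by
  unfold leader; split_ifs <;> norm_num

theorem leader_eq_oneHot {h : W}
    (hh : ∀ h', h' ≠ h → perturbedLoss pol r G ℓ h < perturbedLoss pol r G ℓ h') :
    leader pol r G ℓ = oneHot h := by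
  classical
  ext k
  unfold leader oneHot
  by_cases hk : k = h
  · subst hk
    simpa using hh
  · rw [Pi.single_eq_of_ne hk, if_neg]
    intro hc
    exact lt_asymm (hh k hk) (hc h (Ne.symm hk))

theorem sum_oneHot_mul [Fintype W] (h : W) (f : W → ℝ) : ∑ k, oneHot h k * f k = f h := by
  rw [Finset.sum_eq_single h (fun k _ hk => by simp [oneHot, hk]) (by simp)]
  simp [oneHot]

/-- The perturbed losses of distinct elements are distinct. -/
def NoTies (pol : W → X → A) (r : ℝ) (G : W → ℝ) (ℓ : X → A → ℝ) : Prop :=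
  ∀ h h', h ≠ h' → perturbedLoss pol r G ℓ h ≠ perturbedLoss pol r G ℓ h'

theorem NoTies.leader_eq_oneHot (hℓ : NoTies pol r G ℓ) {h : W}
    (hh : ∀ h', perturbedLoss pol r G ℓ h ≤ perturbedLoss pol r G ℓ h') :
    leader pol r G ℓ = oneHot h :=
  _root_.leader_eq_oneHot fun h' hne => lt_of_le_of_ne (hh h') (hℓ h h' hne.symm)

theorem sum_leader_le_one [Fintype W] : ∑ h, leader pol r G ℓ h ≤ 1 := by
  by_cases hex : ∃ h, ∀ h', h' ≠ h → perturbedLoss pol r G ℓ h < perturbedLoss pol r G ℓ h'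
  · obtain ⟨h, hh⟩ := hex
    rw [leader_eq_oneHot hh]
    simpa using (sum_oneHot_mul h fun _ => 1).le
  · push Not at hex
    rw [Finset.sum_eq_zero]
    · norm_num
    · intro h _
      obtain ⟨h', h1, h2⟩ := hex h
      exact if_neg fun hc => absurd (hc h' h1) (not_lt.mpr h2)

theorem NoTies.sum_leader [Fintype W] [Nonempty W] (hℓ : NoTies pol r G ℓ) :
    ∑ h, leader pol r G ℓ h = 1 := by
  obtain ⟨h, hh⟩ := Finite.exists_min (perturbedLoss pol r G ℓ)
  rw [hℓ.leader_eq_oneHot hh]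
  simpa using (sum_oneHot_mul h fun _ => 1)

theorem NoTies.sum_leader_mul_le [Fintype W] [Nonempty W] (hℓ : NoTies pol r G ℓ) {v : W → ℝ}
    (hv : v ∈ stdSimplex ℝ W) :
    ∑ h, leader pol r G ℓ h * perturbedLoss pol r G ℓ h ≤
      ∑ h, v h * perturbedLoss pol r G ℓ h := by
  obtain ⟨h, hh⟩ := Finite.exists_min (perturbedLoss pol r G ℓ)
  rw [hℓ.leader_eq_oneHot hh, sum_oneHot_mul]
  calc perturbedLoss pol r G ℓ h = ∑ k, v k * perturbedLoss pol r G ℓ h := by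
        rw [← Finset.sum_mul, hv.2, one_mul]
    _ ≤ _ := Finset.sum_le_sum fun k _ => mul_le_mul_of_nonneg_left (hh k) (hv.1 k)

@[fun_prop]
theorem measurable_noise (h : W) : Measurable fun ℓ => noise pol ℓ h := by
  unfold noise; fun_prop

theorem measurable_perturbedLoss (h : W) :
    Measurable fun p : (W → ℝ) × (X → A → ℝ) => perturbedLoss pol r p.1 p.2 h := by
  unfold perturbedLoss noise; fun_prop

theorem measurableSet_noTies [Finite W] :
    MeasurableSet {p : (W → ℝ) × (X → A → ℝ) | NoTies pol r p.1 p.2} := by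
  have : {p : (W → ℝ) × (X → A → ℝ) | NoTies pol r p.1 p.2} = ⋂ h, ⋂ h', ⋂ _ : h ≠ h',
      {p | perturbedLoss pol r p.1 p.2 h = perturbedLoss pol r p.1 p.2 h'}ᶜ := by
    ext p; simp [NoTies]
  rw [this]
  exact .iInter fun h => .iInter fun h' => .iInter fun _ =>
    (measurableSet_eq_fun (measurable_perturbedLoss h) (measurable_perturbedLoss h')).compl

theorem measurable_leader_prod [Finite W] (h : W) :
    Measurable fun p : (W → ℝ) × (X → A → ℝ) => leader pol r p.1 p.2 h := by
  unfold leader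
  refine Measurable.ite ?_ measurable_const measurable_const
  have : {p : (W → ℝ) × (X → A → ℝ) | ∀ h', h' ≠ h →
      perturbedLoss pol r p.1 p.2 h < perturbedLoss pol r p.1 p.2 h'} = ⋂ h', ⋂ _ : h' ≠ h,
      {p | perturbedLoss pol r p.1 p.2 h < perturbedLoss pol r p.1 p.2 h'} := by
    ext p; simp
  rw [this]
  exact .iInter fun h' => .iInter fun _ =>
    measurableSet_lt (measurable_perturbedLoss h) (measurable_perturbedLoss h')

theorem measurable_leader [Finite W] (G : W → ℝ) (h : W) :
    Measurable fun ℓ => leader pol r G ℓ h :=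
  (measurable_leader_prod h).comp measurable_prodMk_left

/-- The features of `h`: the matrix of the one-hot vectors of its actions. -/
noncomputable def features (pol : W → X → A) (h : W) : X → A → ℝ :=
  fun x => oneHot (pol h x)

theorem noise_add_smul_features (t : ℝ) (h k : W) :
    noise pol (ℓ + t • features pol h) k = noise pol ℓ k + t * ∑ x, features pol h x (pol k x) := by
  simp [noise, Finset.sum_add_distrib, Finset.mul_sum]

theorem sum_features_self (h : W) : ∑ x, features pol h x (pol h x) = Fintype.card X := by
  simp [features, oneHot]

theorem sum_features_le (hpol : Function.Injective pol) {h k : W} (hne : k ≠ h) :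
    ∑ x, features pol h x (pol k x) ≤ Fintype.card X - 1 := by
  classical
  obtain ⟨x₀, hx₀⟩ : ∃ x, pol k x ≠ pol h x := by
    by_contra! hc
    exact hne (hpol (funext hc))
  rw [← Finset.add_sum_erase _ _ (Finset.mem_univ x₀)]
  have h0 : features pol h x₀ (pol k x₀) = 0 := by
    simp [features, oneHot, hx₀]
  rw [h0, zero_add]
  calc ∑ x ∈ Finset.univ.erase x₀, features pol h x (pol k x)
      ≤ ∑ x ∈ Finset.univ.erase x₀, (1 : ℝ) := by
        refine Finset.sum_le_sum fun x _ => ?_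
        simp only [features, oneHot, Pi.single_apply]
        split_ifs <;> norm_num
    _ = Fintype.card X - 1 := by
        rw [Finset.sum_const, Finset.card_erase_of_mem (Finset.mem_univ _), nsmul_eq_mul, mul_one,
          Nat.cast_sub (Finset.card_pos.mpr ⟨x₀, Finset.mem_univ _⟩)]
        simp

/-- Favouring `h` at every entry of its features keeps it in the lead when the cumulative losses
change by little: by injectivity of `pol`, every competitor gains less. -/
theorem leader_add_smul_features_le (hpol : Function.Injective pol) {G' : W → ℝ} {t : ℝ}
    (hr : 0 < r) (ht : 0 ≤ t) (h : W) (hG : ∀ k, G k - G h ≤ G' k - G' h + r * t) :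
    leader pol r G (ℓ + t • features pol h) h ≤ leader pol r G' ℓ h := by
  unfold leader
  split_ifs with h1 h2 <;> try norm_num
  refine h2 fun k hk => ?_
  have := h1 k hk
  simp only [perturbedLoss, noise_add_smul_features, sum_features_self] at this ⊢
  have h3 := mul_le_mul_of_nonneg_left (sum_features_le hpol hk) (mul_nonneg hr.le ht)
  nlinarith [hG k]

theorem exponent_features [Fintype A] (t : ℝ) (h : W) :
    ∑ x, ∑ a, ((t • features pol h) x a * ℓ x a - (t • features pol h) x a ^ 2 / 2) =
      t * noise pol ℓ h - t ^ 2 * Fintype.card X / 2 := by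
  have (x : X) : ∑ a, ((t • features pol h) x a * ℓ x a - (t • features pol h) x a ^ 2 / 2) =
      t * ℓ x (pol h x) - t ^ 2 / 2 := by
    rw [Finset.sum_eq_single (pol h x)]
    · simp [features, oneHot]
    · intro a _ ha
      simp [features, oneHot, ha]
    · simp
  simp_rw [this, Finset.sum_sub_distrib, noise, Finset.mul_sum]
  simp
  ring

theorem abs_noise_le [Fintype A] (h : W) : |noise pol ℓ h| ≤ ∑ x, ∑ a, |ℓ x a| :=
  (Finset.abs_sum_le_sum_abs _ _).trans <| Finset.sum_le_sum fun x _ =>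
    Finset.single_le_sum (f := fun a => |ℓ x a|) (fun _ _ => abs_nonneg _) (Finset.mem_univ _)

section Gaussian

variable [Fintype A]

theorem integrable_noise (h : W) : Integrable (fun ℓ => noise pol ℓ h) (gaussianMatrix X A) :=
  integrable_finsetSum _ fun x _ => integrable_gaussianMatrix_entry x _

theorem integral_noise (h : W) : ∫ ℓ, noise pol ℓ h ∂gaussianMatrix X A = 0 := by
  unfold noise
  rw [integral_finsetSum _ fun x _ => integrable_gaussianMatrix_entry x _]
  simp [integral_gaussianMatrix_entry]

theorem integrable_sum_abs :
    Integrable (fun ℓ : X → A → ℝ => ∑ x, ∑ a, |ℓ x a|) (gaussianMatrix X A) :=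
  integrable_finsetSum _ fun x _ => integrable_finsetSum _ fun a _ =>
    (integrable_gaussianMatrix_entry x a).abs

theorem integral_sum_abs_le :
    ∫ ℓ, ∑ x, ∑ a, |ℓ x a| ∂gaussianMatrix X A ≤ Fintype.card X * Fintype.card A := by
  rw [integral_finsetSum _ fun x _ => integrable_finsetSum _ fun a _ =>
    (integrable_gaussianMatrix_entry x a).abs]
  calc _ ≤ ∑ x : X, ∑ a : A, (1 : ℝ) := by
        refine Finset.sum_le_sum fun x _ => ?_
        rw [integral_finsetSum _ fun a _ => (integrable_gaussianMatrix_entry x a).abs]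
        exact Finset.sum_le_sum fun a _ => integral_abs_gaussianMatrix_entry_le x a
    _ = _ := by simp

theorem integrable_exp_noise (t : ℝ) (h : W) :
    Integrable (fun ℓ => Real.exp (t * noise pol ℓ h - t ^ 2 * Fintype.card X / 2))
      (gaussianMatrix X A) := by
  simpa only [exponent_features] using integrable_exp_gaussianMatrix (t • features pol h)

theorem integral_exp_noise (t : ℝ) (h : W) :
    ∫ ℓ, Real.exp (t * noise pol ℓ h - t ^ 2 * Fintype.card X / 2) ∂gaussianMatrix X A = 1 := by
  simpa only [exponent_features] using integral_exp_gaussianMatrix (t • features pol h)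

/-- The difference of two noise variables has no atoms. -/
theorem ae_noise_sub_ne (hpol : Function.Injective pol) {h k : W} (hne : k ≠ h) (c : ℝ) :
    ∀ᵐ ℓ ∂gaussianMatrix X A, noise pol ℓ h - noise pol ℓ k ≠ c := by
  let d : (X → A → ℝ) → ℝ := fun ℓ => noise pol ℓ h - noise pol ℓ k
  have hd : Measurable d := by fun_prop
  set s : ℝ := Fintype.card X - ∑ x, features pol h x (pol k x) with hs
  have hs1 : 1 ≤ s := by linarith [sum_features_le hpol hne]
  -- Translating the noise carries each level set of `d` to every other one, so either all of them
  -- are null or uncountably many disjoint sets have positive measure.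
  have key (t : ℝ) (h0 : gaussianMatrix X A (d ⁻¹' {c + t * s}) = 0) :
      gaussianMatrix X A (d ⁻¹' {c}) = 0 := by
    have hac : (gaussianMatrix X A).map (fun ℓ => ℓ + t • features pol h) ≪ gaussianMatrix X A := by
      rw [gaussianMatrix_map_add]
      exact withDensity_absolutelyContinuous _ _
    have h1 := hac h0
    rw [Measure.map_apply (by fun_prop) (hd (measurableSet_singleton _))] at h1
    convert h1 using 2
    ext ℓ
    simp only [Set.mem_preimage, Set.mem_singleton_iff, d, noise_add_smul_features,
      sum_features_self, hs]
    constructor <;> intro h <;> linarith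
  have hcount := Measure.countable_meas_pos_of_disjoint_iUnion (μ := gaussianMatrix X A)
    (As := fun t : ℝ => d ⁻¹' {c + t * s}) (fun t => hd (measurableSet_singleton _))
    (by
      intro t t' htt'
      refine Disjoint.preimage _ (Set.disjoint_singleton.mpr fun h => htt' ?_)
      have : t * s = t' * s := by linarith
      exact mul_right_cancel₀ (by positivity) this)
  obtain ⟨t, ht⟩ : ∃ t : ℝ, ¬ 0 < gaussianMatrix X A (d ⁻¹' {c + t * s}) := by
    by_contra! hc
    refine Cardinal.not_countable_real (hcount.mono fun t _ => hc t)
  exact measure_eq_zero_iff_ae_notMem.mp (key t (by simpa using ht))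

theorem ae_noTies [Finite W] (hpol : Function.Injective pol) (hr : r ≠ 0) (G : W → ℝ) :
    ∀ᵐ ℓ ∂gaussianMatrix X A, NoTies pol r G ℓ := by
  unfold NoTies
  rw [ae_all_iff]; intro h
  rw [ae_all_iff]; intro k
  by_cases hne : h = k
  · exact .of_forall fun _ hc => absurd hne hc
  filter_upwards [ae_noise_sub_ne hpol (Ne.symm hne) ((G k - G h) / r)] with ℓ hℓ _ hc
  refine hℓ ?_
  rw [eq_div_iff hr]
  simp only [perturbedLoss] at hc
  linarith

end Gaussian

end Leader

/-! ### Regret of the law of the perturbed leader -/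

section Regret

variable {W X A : Type*} [Fintype X] [Fintype A]
variable {pol : W → X → A} {r : ℝ} {G : W → ℝ}

/-- The probability that the perturbed leader for the cumulative losses `G` is `h`. -/
noncomputable def leaderProb (pol : W → X → A) (r : ℝ) (G : W → ℝ) (h : W) : ℝ :=
  ∫ ℓ, leader pol r G ℓ h ∂gaussianMatrix X A

theorem integrable_leader [Finite W] (G : W → ℝ) (h : W) :
    Integrable (fun ℓ => leader pol r G ℓ h) (gaussianMatrix X A) :=
  .of_mem_Icc 0 1 (measurable_leader G h).aemeasurable
    (.of_forall fun _ => ⟨leader_nonneg h, leader_le_one h⟩)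

theorem integrable_mul_leader [Finite W] {f : (X → A → ℝ) → ℝ}
    (hf : Integrable f (gaussianMatrix X A)) (G : W → ℝ) (h : W) :
    Integrable (fun ℓ => f ℓ * leader pol r G ℓ h) (gaussianMatrix X A) :=
  hf.mul_bdd (c := 1) (measurable_leader G h).aestronglyMeasurable
    (.of_forall fun _ => by
      rw [Real.norm_of_nonneg (leader_nonneg h)]; exact leader_le_one h)

theorem measurable_leaderProb [Finite W] (h : W) :
    Measurable fun G => leaderProb pol r G h :=
  ((measurable_leader_prod h).stronglyMeasurable.integral_prod_right
    (ν := gaussianMatrix X A)).measurable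

theorem sum_leaderProb [Fintype W] [Nonempty W] (hpol : Function.Injective pol) (hr : r ≠ 0)
    (G : W → ℝ) : ∑ h, leaderProb pol r G h = 1 := by
  unfold leaderProb
  rw [← integral_finsetSum _ fun h _ => integrable_leader G h]
  have : (fun ℓ => ∑ h, leader pol r G ℓ h) =ᵐ[gaussianMatrix X A] fun _ => 1 := by
    filter_upwards [ae_noTies hpol hr G] with ℓ hℓ using hℓ.sum_leader
  simp [integral_congr_ae this]

/-- A change from `G` to `G'` costs `h` little probability of leading: translating the noise by
`t • features pol h` makes up for it, and the density of the translated noise is at least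
`1 + t * noise - t ^ 2 * |X| / 2`. -/
theorem leaderProb_sub_le [Finite W] (hpol : Function.Injective pol) (hr : 0 < r) {G' : W → ℝ}
    {t : ℝ} (ht : 0 ≤ t) (h : W) (hG : ∀ k, G k - G h ≤ G' k - G' h + r * t) :
    leaderProb pol r G h - leaderProb pol r G' h ≤
      ∫ ℓ, (t ^ 2 * Fintype.card X / 2 + t * ∑ x, ∑ a, |ℓ x a|) * leader pol r G ℓ h
        ∂gaussianMatrix X A := by
  have hint : Integrable (fun ℓ : X → A → ℝ =>
      t ^ 2 * Fintype.card X / 2 + t * ∑ x, ∑ a, |ℓ x a|) (gaussianMatrix X A) :=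
    (integrable_const _).add (integrable_sum_abs.const_mul t)
  have h1 : ∫ ℓ, leader pol r G (ℓ + t • features pol h) h ∂gaussianMatrix X A ≤
      leaderProb pol r G' h :=
    integral_mono_of_nonneg (.of_forall fun _ => leader_nonneg h) (integrable_leader G' h)
      (.of_forall fun ℓ => leader_add_smul_features_le hpol hr ht h hG)
  rw [integral_gaussianMatrix_comp_add _ (measurable_leader G h)] at h1
  simp only [exponent_features] at h1
  have h2 : leaderProb pol r G h - ∫ ℓ, (t ^ 2 * Fintype.card X / 2 + t * ∑ x, ∑ a, |ℓ x a|) *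
      leader pol r G ℓ h ∂gaussianMatrix X A ≤
      ∫ ℓ, Real.exp (t * noise pol ℓ h - t ^ 2 * Fintype.card X / 2) * leader pol r G ℓ h
        ∂gaussianMatrix X A := by
    unfold leaderProb
    rw [← integral_sub (integrable_leader G h) (integrable_mul_leader hint G h)]
    refine integral_mono ((integrable_leader G h).sub (integrable_mul_leader hint G h))
      (integrable_mul_leader (integrable_exp_noise t h) G h) fun ℓ => ?_
    have h3 := Real.add_one_le_exp (t * noise pol ℓ h - t ^ 2 * Fintype.card X / 2)
    have h4 : -(∑ x, ∑ a, |ℓ x a|) ≤ noise pol ℓ h :=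
      (neg_le_neg (abs_noise_le h)).trans (neg_abs_le _)
    have h5 := mul_le_mul_of_nonneg_left h4 ht
    calc leader pol r G ℓ h - (t ^ 2 * Fintype.card X / 2 + t * ∑ x, ∑ a, |ℓ x a|) *
          leader pol r G ℓ h
        = (1 - (t ^ 2 * Fintype.card X / 2 + t * ∑ x, ∑ a, |ℓ x a|)) * leader pol r G ℓ h := by
          ring
      _ ≤ _ := mul_le_mul_of_nonneg_right (by linarith) (leader_nonneg h)
  linarith

/-- The law of the perturbed leader is stable: adding a loss vector `g` with entries in `[-μ, μ]`
moves it little, as measured by `g` itself. -/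
theorem sum_mul_leaderProb_sub_le [Fintype W] [Nonempty W] (hpol : Function.Injective pol)
    (hr : 0 < r) {μ : ℝ} {g : W → ℝ} (hg : ∀ h, |g h| ≤ μ) {t : ℝ} (ht : 0 ≤ t)
    (hrt : 2 * μ ≤ r * t) (G : W → ℝ) :
    ∑ h, g h * (leaderProb pol r G h - leaderProb pol r (G + g) h) ≤
      2 * μ * (t ^ 2 * Fintype.card X / 2 + t * (Fintype.card X * Fintype.card A)) := by
  have hg' (h : W) : -μ ≤ g h ∧ g h ≤ μ := abs_le.mp (hg h)
  have hμ : 0 ≤ μ := (abs_nonneg _).trans (hg (Classical.arbitrary W))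
  set b : (X → A → ℝ) → ℝ := fun ℓ => t ^ 2 * Fintype.card X / 2 + t * ∑ x, ∑ a, |ℓ x a| with hb
  have hb0 (ℓ) : 0 ≤ b ℓ := by positivity
  have hint : Integrable b (gaussianMatrix X A) :=
    (integrable_const _).add (integrable_sum_abs.const_mul t)
  have hsum : ∑ h, (leaderProb pol r G h - leaderProb pol r (G + g) h) = 0 := by
    rw [Finset.sum_sub_distrib, sum_leaderProb hpol hr.ne', sum_leaderProb hpol hr.ne', sub_self]
  -- Adding `μ` to `g`, which changes nothing as both laws have mass one, makes its entries
  -- nonnegative, so that the one-sided bound of `leaderProb_sub_le` is enough.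
  calc ∑ h, g h * (leaderProb pol r G h - leaderProb pol r (G + g) h)
      = ∑ h, (g h + μ) * (leaderProb pol r G h - leaderProb pol r (G + g) h) := by
        simp_rw [add_mul, Finset.sum_add_distrib, ← Finset.mul_sum, hsum]
        simp
    _ ≤ ∑ h, 2 * μ * ∫ ℓ, b ℓ * leader pol r G ℓ h ∂gaussianMatrix X A := by
        refine Finset.sum_le_sum fun h _ => ?_
        refine (mul_le_mul_of_nonneg_left (leaderProb_sub_le hpol hr ht h fun k => ?_)
          (by linarith [hg' h])).trans (mul_le_mul_of_nonneg_right (by linarith [hg' h]) ?_)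
        · simp only [Pi.add_apply]
          linarith [hg' h, hg' k]
        · exact integral_nonneg fun ℓ => mul_nonneg (hb0 ℓ) (leader_nonneg h)
    _ = 2 * μ * ∫ ℓ, ∑ h, b ℓ * leader pol r G ℓ h ∂gaussianMatrix X A := by
        rw [integral_finsetSum _ fun h _ => integrable_mul_leader hint G h, Finset.mul_sum]
    _ ≤ 2 * μ * ∫ ℓ, b ℓ ∂gaussianMatrix X A := by
        refine mul_le_mul_of_nonneg_left (integral_mono
          (integrable_finsetSum _ fun h _ => integrable_mul_leader hint G h) hint fun ℓ => ?_)
          (by positivity)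
        simp only [← Finset.mul_sum]
        exact mul_le_of_le_one_right (hb0 ℓ) sum_leader_le_one
    _ ≤ _ := by
        refine mul_le_mul_of_nonneg_left ?_ (by positivity)
        rw [hb, integral_add (integrable_const _) (integrable_sum_abs.const_mul t),
          integral_const_mul]
        simp only [integral_const, probReal_univ, smul_eq_mul, one_mul]
        gcongr
        exact integral_sum_abs_le

/-- The expected perturbed loss of the perturbed leader, the potential of the regret analysis. -/
noncomputable def leaderPotential [Fintype W] (pol : W → X → A) (r : ℝ) (G : W → ℝ) : ℝ :=
  ∫ ℓ, ∑ h, leader pol r G ℓ h * perturbedLoss pol r G ℓ h ∂gaussianMatrix X A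

theorem integrable_perturbedLoss (G : W → ℝ) (h : W) :
    Integrable (fun ℓ => perturbedLoss pol r G ℓ h) (gaussianMatrix X A) :=
  (integrable_const _).add ((integrable_noise h).const_mul r)

theorem integrable_sum_leader_mul [Fintype W] (G G' : W → ℝ) :
    Integrable (fun ℓ => ∑ h, leader pol r G ℓ h * perturbedLoss pol r G' ℓ h)
      (gaussianMatrix X A) := by
  simp_rw [mul_comm (leader _ _ _ _ _)]
  exact integrable_finsetSum _ fun h _ => integrable_mul_leader (integrable_perturbedLoss G' h) G h

theorem leaderPotential_le [Fintype W] [Nonempty W] (hpol : Function.Injective pol) (hr : r ≠ 0)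
    (G : W → ℝ) {v : W → ℝ} (hv : v ∈ stdSimplex ℝ W) :
    leaderPotential pol r G ≤ ∑ h, v h * G h := by
  have hint (h : W) : Integrable (fun ℓ => v h * perturbedLoss pol r G ℓ h)
    (gaussianMatrix X A) := (integrable_perturbedLoss G h).const_mul _
  calc leaderPotential pol r G
      ≤ ∫ ℓ, ∑ h, v h * perturbedLoss pol r G ℓ h ∂gaussianMatrix X A := by
        refine integral_mono_ae (integrable_sum_leader_mul G G)
          (integrable_finsetSum _ fun h _ => hint h) ?_
        filter_upwards [ae_noTies hpol hr G] with ℓ hℓ using hℓ.sum_leader_mul_le hv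
    _ = ∑ h, v h * G h := by
        rw [integral_finsetSum _ fun h _ => hint h]
        refine Finset.sum_congr rfl fun h _ => ?_
        rw [integral_const_mul]
        unfold perturbedLoss
        rw [integral_add (integrable_const _) ((integrable_noise h).const_mul r),
          integral_const_mul, integral_noise]
        simp

/-- Be the leader: the leader after the loss vector `g` is revealed pays at most the growth of the
potential. -/
theorem leaderPotential_add_le [Fintype W] [Nonempty W] (hpol : Function.Injective pol)
    (hr : r ≠ 0) (G g : W → ℝ) :
    leaderPotential pol r G + ∑ h, g h * leaderProb pol r (G + g) h ≤
      leaderPotential pol r (G + g) := by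
  have hint (h : W) : Integrable (fun ℓ => g h * leader pol r (G + g) ℓ h)
    (gaussianMatrix X A) := (integrable_leader _ h).const_mul _
  unfold leaderPotential leaderProb
  simp_rw [← integral_const_mul]
  rw [← integral_finsetSum _ fun h _ => hint h, ← integral_add (integrable_sum_leader_mul _ _)
    (integrable_finsetSum _ fun h _ => hint h)]
  refine integral_mono_ae ((integrable_sum_leader_mul _ _).add
    (integrable_finsetSum _ fun h _ => hint h)) (integrable_sum_leader_mul _ _) ?_
  filter_upwards [ae_noTies hpol hr G, ae_noTies hpol hr (G + g)] with ℓ h1 h2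
  have h3 := h1.sum_leader_mul_le (v := leader pol r (G + g) ℓ)
    ⟨fun h => leader_nonneg h, h2.sum_leader⟩
  calc _ ≤ ∑ h, leader pol r (G + g) ℓ h * perturbedLoss pol r G ℓ h +
        ∑ h, g h * leader pol r (G + g) ℓ h := by gcongr
    _ = _ := by
        rw [← Finset.sum_add_distrib]
        refine Finset.sum_congr rfl fun h _ => ?_
        simp only [perturbedLoss, Pi.add_apply]
        ring

/-- The potential starts at minus the expected maximum of the Gaussian process `noise`, bounded by
the exponential moment method with parameter `s`. -/
theorem neg_le_leaderPotential_zero [Fintype W] [Nonempty W] (hpol : Function.Injective pol)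
    (hr : 0 < r) {s : ℝ} (hs : 0 < s) :
    -(r * (Real.log (Fintype.card W) / s + s * Fintype.card X / 2)) ≤
      leaderPotential pol r (0 : W → ℝ) := by
  set B : ℝ := (Fintype.card W : ℝ)
  have hB : 0 < B := by simp [B, Fintype.card_pos]
  set M : (X → A → ℝ) → ℝ := fun ℓ =>
    ∑ k, Real.exp ((-s) * noise pol ℓ k - (-s) ^ 2 * Fintype.card X / 2) with hM
  have hMint : Integrable M (gaussianMatrix X A) :=
    integrable_finsetSum _ fun k _ => integrable_exp_noise _ k
  have hMi : ∫ ℓ, M ℓ ∂gaussianMatrix X A = B := by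
    rw [hM, integral_finsetSum _ fun k _ => integrable_exp_noise _ k]
    simp_rw [integral_exp_noise]
    simp [B]
  -- The bound `y ≤ exp y - 1` at `y = -s * noise - log B - s² |X| / 2`.
  have hpt (ℓ : X → A → ℝ) (h : W) :
      -(r / s) * (Real.log B + s ^ 2 * Fintype.card X / 2 - 1 + M ℓ / B) ≤
        perturbedLoss pol r 0 ℓ h := by
    have h1 := Real.add_one_le_exp
      ((-s) * noise pol ℓ h - (-s) ^ 2 * Fintype.card X / 2 - Real.log B)
    rw [Real.exp_sub _ (Real.log B), Real.exp_log hB] at h1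
    have h2 : Real.exp ((-s) * noise pol ℓ h - (-s) ^ 2 * Fintype.card X / 2) ≤ M ℓ :=
      Finset.single_le_sum (f := fun k =>
        Real.exp ((-s) * noise pol ℓ k - (-s) ^ 2 * Fintype.card X / 2))
        (fun _ _ => (Real.exp_pos _).le) (Finset.mem_univ h)
    have h3 := (div_le_div_iff_of_pos_right hB).mpr h2
    have h4 : -(s * noise pol ℓ h) ≤
        Real.log B + s ^ 2 * Fintype.card X / 2 - 1 + M ℓ / B := by linarith
    have h5 := mul_le_mul_of_nonneg_left h4 (div_pos hr hs).le
    have h6 : r / s * -(s * noise pol ℓ h) = -(r * noise pol ℓ h) := by field_simp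
    simp only [perturbedLoss, Pi.zero_apply, zero_add]
    linarith
  have hint : Integrable (fun ℓ =>
      -(r / s) * (Real.log B + s ^ 2 * Fintype.card X / 2 - 1 + M ℓ / B)) (gaussianMatrix X A) :=
    ((integrable_const _).add (hMint.div_const B)).const_mul _
  calc -(r * (Real.log B / s + s * Fintype.card X / 2))
      = ∫ ℓ, -(r / s) * (Real.log B + s ^ 2 * Fintype.card X / 2 - 1 + M ℓ / B)
          ∂gaussianMatrix X A := by
        rw [integral_const_mul, integral_add (integrable_const _) (hMint.div_const B),
          integral_div, hMi, integral_const, probReal_univ, one_smul]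
        field_simp
        ring
    _ ≤ _ := by
        refine integral_mono_ae hint (integrable_sum_leader_mul _ _) ?_
        filter_upwards [ae_noTies hpol hr.ne' 0] with ℓ hℓ
        calc _ = ∑ h, leader pol r 0 ℓ h *
              (-(r / s) * (Real.log B + s ^ 2 * Fintype.card X / 2 - 1 + M ℓ / B)) := by
              rw [← Finset.sum_mul, hℓ.sum_leader, one_mul]
          _ ≤ _ := Finset.sum_le_sum fun h _ =>
              mul_le_mul_of_nonneg_left (hpt ℓ h) (leader_nonneg h)

/-- The regret of playing the law of the perturbed leader. -/
theorem leaderProb_regret_le [Fintype W] [Nonempty W] (hpol : Function.Injective pol)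
    (hr : 0 < r) {N : ℕ} {μ : ℝ} {g : Fin N → W → ℝ} (hg : ∀ n h, |g n h| ≤ μ) {t : ℝ}
    (ht : 0 ≤ t) (hrt : 2 * μ ≤ r * t) {s : ℝ} (hs : 0 < s) {v : W → ℝ}
    (hv : v ∈ stdSimplex ℝ W) :
    ∑ n, g n ⬝ᵥ leaderProb pol r (∑ i ∈ Finset.Iio n, g i) - ∑ n, g n ⬝ᵥ v ≤
      r * (Real.log (Fintype.card W) / s + s * Fintype.card X / 2) +
      N * (2 * μ * (t ^ 2 * Fintype.card X / 2 + t * (Fintype.card X * Fintype.card A))) := by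
  set F : ℕ → ℝ := fun m => leaderPotential pol r (∑ i : Fin N with i.val < m, g i) with hF
  have hstep (n : Fin N) : g n ⬝ᵥ leaderProb pol r (∑ i ∈ Finset.Iio n, g i) ≤
      (F (n + 1) - F n) +
        2 * μ * (t ^ 2 * Fintype.card X / 2 + t * (Fintype.card X * Fintype.card A)) := by
    have h0 : (∑ i : Fin N with i.val < n.val, g i) = ∑ i ∈ Finset.Iio n, g i :=
      Finset.sum_congr (by ext i; simp) fun _ _ => rfl
    have h1 : (∑ i : Fin N with i.val < n.val + 1, g i) = (∑ i ∈ Finset.Iio n, g i) + g n := by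
      rw [add_comm _ (g n), ← Finset.sum_insert (by simp)]
      refine Finset.sum_congr ?_ fun _ _ => rfl
      ext i
      simp [le_iff_eq_or_lt, Fin.ext_iff]
    have h2 := leaderPotential_add_le hpol hr.ne' (∑ i ∈ Finset.Iio n, g i) (g n)
    have h3 := sum_mul_leaderProb_sub_le hpol hr (hg n) ht hrt (∑ i ∈ Finset.Iio n, g i)
    simp_rw [mul_sub, Finset.sum_sub_distrib] at h3
    simp only [hF, h0, h1, dotProduct]
    linarith
  have htel : ∑ n : Fin N, (F (n + 1) - F n) = F N - F 0 := by
    rw [Fin.sum_univ_eq_sum_range (fun m => F (m + 1) - F m) N, Finset.sum_range_sub]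
  have hN : F N ≤ ∑ n, g n ⬝ᵥ v := by
    refine (leaderPotential_le hpol hr.ne' _ hv).trans_eq ?_
    have : Finset.univ.filter (fun i : Fin N => i.val < N) = Finset.univ := by simp
    simp only [this, Finset.sum_apply, Finset.mul_sum, dotProduct]
    rw [Finset.sum_comm]
    simp_rw [mul_comm]
  have h0 : -(r * (Real.log (Fintype.card W) / s + s * Fintype.card X / 2)) ≤ F 0 := by
    refine (neg_le_leaderPotential_zero hpol hr hs).trans_eq ?_
    simp [hF]
  have := Finset.sum_le_sum fun n (_ : n ∈ Finset.univ) => hstep n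
  rw [Finset.sum_add_distrib, htel] at this
  simp only [Finset.sum_const, Finset.card_univ, Fintype.card_fin, nsmul_eq_mul] at this
  linarith

end Regret

/-! ### Concentration of the sampled leaders -/

section Concentration

variable {W X A : Type*} [Fintype W] [Fintype X] [Fintype A]
variable {pol : W → X → A} {r : ℝ}

/-- The sum over the `T` draws of the deviation of the value of `f` at the perturbed leader from
its mean. -/
noncomputable def leaderDeviation (pol : W → X → A) (r : ℝ) {T : ℕ} (G : W → ℝ)
    (L : Fin T → X → A → ℝ) (f : W → ℝ) : ℝ :=
  ∑ j, ∑ h, f h * (leader pol r G (L j) h - leaderProb pol r G h)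

/-- Hoeffding's inequality for the perturbed leaders of independent draws. -/
theorem measure_le_leaderDeviation_le {T : ℕ} (G : W → ℝ) {f : W → ℝ} (hf : ∀ h, |f h| ≤ 1)
    {ε : ℝ} (hε : 0 ≤ ε) :
    (Measure.pi fun _ : Fin T => gaussianMatrix X A)
        {L | T * ε ≤ leaderDeviation pol r G L f} ≤
      ENNReal.ofReal (Real.exp (-(T * ε ^ 2 / 2))) := by
  set Y : (X → A → ℝ) → ℝ := fun ℓ => ∑ h, f h * leader pol r G ℓ h with hY
  have hYm : Measurable Y :=
    Finset.measurable_sum _ fun h _ => (measurable_leader G h).const_mul (f h)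
  have hYb (ℓ) : Y ℓ ∈ Set.Icc (-1 : ℝ) 1 := by
    rw [Set.mem_Icc, ← abs_le]
    refine (Finset.abs_sum_le_sum_abs _ _).trans (le_trans ?_ (sum_leader_le_one (pol := pol)
      (r := r) (G := G) (ℓ := ℓ)))
    refine Finset.sum_le_sum fun h _ => ?_
    rw [abs_mul, abs_of_nonneg (leader_nonneg h)]
    exact mul_le_of_le_one_left (leader_nonneg h) (hf h)
  have hYi : ∫ ℓ, Y ℓ ∂gaussianMatrix X A = ∑ h, f h * leaderProb pol r G h := by
    rw [hY, integral_finsetSum _ fun h _ => (integrable_leader G h).const_mul _]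
    simp_rw [integral_const_mul, leaderProb]
  have hsub := hasSubgaussianMGF_of_mem_Icc (μ := gaussianMatrix X A) hYm.aemeasurable
    (.of_forall hYb)
  have hdev (L : Fin T → X → A → ℝ) : leaderDeviation pol r G L f =
      ∑ j, (Y (L j) - ∫ ℓ, Y ℓ ∂gaussianMatrix X A) := by
    rw [hYi]
    simp only [leaderDeviation, hY, mul_sub, Finset.sum_sub_distrib]
  have hmp (j : Fin T) := measurePreserving_eval (fun _ : Fin T => gaussianMatrix X A) j
  have hsubj (j : Fin T) : HasSubgaussianMGF
      (fun L : Fin T → X → A → ℝ => Y (L j) - ∫ ℓ, Y ℓ ∂gaussianMatrix X A)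
      ((‖(1 : ℝ) - -1‖₊ / 2) ^ 2) (Measure.pi fun _ : Fin T => gaussianMatrix X A) := by
    refine HasSubgaussianMGF.of_map (hmp j).aemeasurable
      (X := fun ℓ => Y ℓ - ∫ ℓ, Y ℓ ∂gaussianMatrix X A) ?_
    rw [(hmp j).map_eq]
    exact hsub
  have hoeff := HasSubgaussianMGF.measure_sum_ge_le_of_iIndepFun
    (iIndepFun_pi (μ := fun _ : Fin T => gaussianMatrix X A)
      (X := fun _ ℓ => Y ℓ - ∫ ℓ, Y ℓ ∂gaussianMatrix X A)
      fun _ => (hYm.sub_const _).aemeasurable)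
    (s := Finset.univ) (fun j _ => hsubj j) (ε := T * ε) (by positivity)
  simp only [← hdev] at hoeff
  rw [← ofReal_measureReal]
  refine ENNReal.ofReal_le_ofReal (hoeff.trans_eq ?_)
  congr 1
  have : ((‖(1 : ℝ) - -1‖₊ / 2) ^ 2 : NNReal) = 1 := by
    have h2 : ‖(1 : ℝ) - -1‖₊ = 2 := by
      ext; norm_num
    rw [h2]; simp
  simp only [this]
  rcases Nat.eq_zero_or_pos T with rfl | hT
  · simp
  · have : (0 : ℝ) < T := by exact_mod_cast hT
    simp
    field_simp

/-- The draws are good for the test functions `f`: no draw has ties and no deviation reaches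
`T * ε`. -/
def GoodDraws (pol : W → X → A) (r : ℝ) {T : ℕ} {ι : Type*} (f : ι → W → ℝ) (ε : ℝ) (G : W → ℝ)
    (L : Fin T → X → A → ℝ) : Prop :=
  (∀ j, NoTies pol r G (L j)) ∧ ∀ i, leaderDeviation pol r G L (f i) < T * ε

theorem measurableSet_goodDraws {T : ℕ} {ι : Type*} [Finite ι] (f : ι → W → ℝ) (ε : ℝ) :
    MeasurableSet {p : (W → ℝ) × (Fin T → X → A → ℝ) | GoodDraws pol r f ε p.1 p.2} := by
  have hproj (j : Fin T) : Measurable fun p : (W → ℝ) × (Fin T → X → A → ℝ) => (p.1, p.2 j) := by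
    fun_prop
  refine MeasurableSet.inter
    (s₁ := {p : (W → ℝ) × (Fin T → X → A → ℝ) | ∀ j, NoTies pol r p.1 (p.2 j)})
    (s₂ := {p : (W → ℝ) × (Fin T → X → A → ℝ) |
      ∀ i, leaderDeviation pol r p.1 p.2 (f i) < T * ε}) ?_ ?_
  · rw [Set.ofPred_forall]
    exact .iInter fun j => hproj j measurableSet_noTies
  · rw [Set.ofPred_forall]
    refine .iInter fun i => measurableSet_lt ?_ measurable_const
    exact Finset.measurable_sum _ fun j _ => Finset.measurable_sum _ fun h _ =>
      (((measurable_leader_prod h).comp (hproj j)).sub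
        ((measurable_leaderProb h).comp measurable_fst)).const_mul _

theorem measure_not_goodDraws_le (hpol : Function.Injective pol) (hr : r ≠ 0) {T : ℕ} {ι : Type*}
    [Fintype ι] {f : ι → W → ℝ} (hf : ∀ i h, |f i h| ≤ 1) {ε : ℝ} (hε : 0 ≤ ε) (G : W → ℝ) :
    (Measure.pi fun _ : Fin T => gaussianMatrix X A) {L | ¬ GoodDraws pol r f ε G L} ≤
      Fintype.card ι * ENNReal.ofReal (Real.exp (-(T * ε ^ 2 / 2))) := by
  set ν := Measure.pi fun _ : Fin T => gaussianMatrix X A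
  have hties : ν {L | ¬ ∀ j, NoTies pol r G (L j)} = 0 := by
    rw [← ae_iff, ae_all_iff]
    exact fun j => (measurePreserving_eval (fun _ : Fin T => gaussianMatrix X A)
      j).quasiMeasurePreserving.ae (ae_noTies hpol hr G)
  calc ν {L | ¬ GoodDraws pol r f ε G L}
      ≤ ν ({L | ¬ ∀ j, NoTies pol r G (L j)} ∪
          ⋃ i, {L | T * ε ≤ leaderDeviation pol r G L (f i)}) := by
        refine measure_mono fun L hL => ?_
        simp only [Set.mem_ofPred_eq, GoodDraws, not_and_or] at hL
        refine hL.imp id fun h => ?_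
        simpa using h
    _ ≤ 0 + ∑ i, ν {L | T * ε ≤ leaderDeviation pol r G L (f i)} :=
        (measure_union_le _ _).trans (add_le_add hties.le (measure_iUnion_fintype_le _ _))
    _ ≤ ∑ i : ι, ENNReal.ofReal (Real.exp (-(T * ε ^ 2 / 2))) := by
        rw [zero_add]
        exact Finset.sum_le_sum fun i _ => measure_le_leaderDeviation_le G (hf i) hε
    _ = _ := by simp

/-- The cumulative losses may be random as long as they are independent of the draws: condition on
them. -/
theorem measure_not_goodDraws_comp_le (hpol : Function.Injective pol) (hr : r ≠ 0) {T : ℕ}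
    {ι : Type*} [Fintype ι] {f : ι → W → ℝ} (hf : ∀ i h, |f i h| ≤ 1) {ε : ℝ} (hε : 0 ≤ ε)
    {Ω : Type*} [MeasurableSpace Ω] {P : Measure Ω} [IsProbabilityMeasure P]
    {G : Ω → W → ℝ} {L : Ω → Fin T → X → A → ℝ} (hG : AEMeasurable G P)
    (hL : HasLaw L (Measure.pi fun _ : Fin T => gaussianMatrix X A) P) (hind : IndepFun G L P) :
    P {ω | ¬ GoodDraws pol r f ε (G ω) (L ω)} ≤
      Fintype.card ι * ENNReal.ofReal (Real.exp (-(T * ε ^ 2 / 2))) := by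
  have hmeas := (measurableSet_goodDraws (pol := pol) (r := r) (T := T) f ε).compl
  have hGp : IsProbabilityMeasure (P.map G) := Measure.isProbabilityMeasure_map hG
  calc P {ω | ¬ GoodDraws pol r f ε (G ω) (L ω)}
      = P.map (fun ω => (G ω, L ω)) {p | GoodDraws pol r f ε p.1 p.2}ᶜ := by
        rw [Measure.map_apply_of_aemeasurable (hG.prodMk hL.aemeasurable) hmeas]
        rfl
    _ = ∫⁻ G', (Measure.pi fun _ : Fin T => gaussianMatrix X A)
          {L | ¬ GoodDraws pol r f ε G' L} ∂P.map G := by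
        rw [hind.map_prod_eq_prod_map_map hG hL.aemeasurable, hL.map_eq,
          Measure.prod_apply hmeas]
        rfl
    _ ≤ ∫⁻ _, Fintype.card ι * ENNReal.ofReal (Real.exp (-(T * ε ^ 2 / 2))) ∂P.map G :=
        lintegral_mono fun G' => measure_not_goodDraws_le hpol hr hf hε G'
    _ = _ := by simp

end Concentration

/-! ### Policies, data sets and the oracle -/

section Oracle

variable {S A : Type*}

/-- The restrictions of the policies of `𝓑` to `𝓧`. -/
def restrictPolicy (𝓑 : Finset (S → A)) (𝓧 : Finset S) : 𝓑 → 𝓧 → A :=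
  fun h x => h.1 x.1

theorem IsSeparator.injective_restrictPolicy {𝓑 : Finset (S → A)} {𝓧 : Finset S}
    (h : IsSeparator 𝓧 𝓑) : Function.Injective (restrictPolicy 𝓑 𝓧) := by
  intro f g hfg
  by_contra hne
  obtain ⟨x, hx, hxne⟩ := h f f.2 g g.2 fun hc => hne (Subtype.ext hc)
  exact hxne (congrFun hfg ⟨x, hx⟩)

theorem sum_map_toExamples {K : ℕ} (D : Fin K → CSCExample S A) (f : CSCExample S A → ℝ) :
    ((toExamples D).map f).sum = ∑ k, f (D k) := by
  rw [toExamples, Multiset.map_map]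
  rfl

theorem lossVector_toExamples {𝓑 : Finset (S → A)} {K : ℕ} (D : Fin K → CSCExample S A) (h : 𝓑) :
    lossVector 𝓑 (toExamples D) h = (∑ k, (D k).2 (h.1 (D k).1)) / K := by
  have hcard : Multiset.card (toExamples D) = K := by simp [toExamples]
  rw [lossVector, empCost, sum_map_toExamples, hcard]

theorem abs_lossVector_le {𝓑 : Finset (S → A)} {K : ℕ} (hK : 1 ≤ K) {μ : ℝ}
    {D : Fin K → CSCExample S A} (hD : ∀ k a, |(D k).2 a| ≤ μ) (h : 𝓑) :
    |lossVector 𝓑 (toExamples D) h| ≤ μ := by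
  have hK' : (0 : ℝ) < K := by exact_mod_cast hK
  rw [lossVector_toExamples, abs_div, abs_of_pos hK', div_le_iff₀ hK']
  calc _ ≤ ∑ k, |(D k).2 (h.1 (D k).1)| := Finset.abs_sum_le_sum_abs _ _
    _ ≤ ∑ k : Fin K, μ := Finset.sum_le_sum fun k _ => hD k _
    _ = μ * K := by simp [mul_comm]

/-- Up to normalization, the empirical cost on the past examples and the perturbation set is the
perturbed cumulative loss. -/
theorem empCost_past_add_perturbationSet {𝓑 : Finset (S → A)} {𝓧 : Finset S} {N K : ℕ}
    (hK : 1 ≤ K) (D : Fin N → Fin K → CSCExample S A) (s : Finset (Fin N)) (η : ℝ)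
    (ℓ : 𝓧 → A → ℝ) (h : 𝓑) :
    empCost (∑ i ∈ s, toExamples (D i) + perturbationSet 𝓧 ((K : ℝ) / η) ℓ) h.1 =
      K / (Multiset.card (∑ i ∈ s, toExamples (D i) + perturbationSet 𝓧 ((K : ℝ) / η) ℓ) : ℝ) *
        perturbedLoss (restrictPolicy 𝓑 𝓧) (1 / η)
          (∑ i ∈ s, lossVector 𝓑 (toExamples (D i))) ℓ h := by
  have hK' : (K : ℝ) ≠ 0 := by positivity
  have hpast : ((∑ i ∈ s, toExamples (D i)).map fun e => e.2 (h.1 e.1)).sum =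
      K * (∑ i ∈ s, lossVector 𝓑 (toExamples (D i))) h := by
    have := map_sum (Multiset.sumAddMonoidHom.comp
      (Multiset.mapAddMonoidHom fun e : CSCExample S A => e.2 (h.1 e.1)))
      (fun i => toExamples (D i)) s
    simp only [AddMonoidHom.comp_apply, Multiset.coe_mapAddMonoidHom,
      Multiset.coe_sumAddMonoidHom] at this
    rw [this, Finset.sum_apply, Finset.mul_sum]
    refine Finset.sum_congr rfl fun i _ => ?_
    rw [lossVector_toExamples, mul_div_cancel₀ _ hK', sum_map_toExamples]
  have hpert : ((perturbationSet 𝓧 ((K : ℝ) / η) ℓ).map fun e => e.2 (h.1 e.1)).sum =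
      K * (1 / η * noise (restrictPolicy 𝓑 𝓧) ℓ h) := by
    simp only [perturbationSet, Multiset.map_map, Function.comp_def, Pi.smul_apply, smul_eq_mul,
      noise, restrictPolicy, Finset.mul_sum]
    refine Finset.sum_congr rfl fun x _ => ?_
    ring
  rw [empCost, Multiset.map_add, Multiset.sum_add, hpast, hpert, perturbedLoss]
  ring

/-- In the absence of ties the answer of an arbitrary, possibly non-measurable, oracle is the
measurable `leader`. -/
theorem IsCSCOracle.oneHot_eq_leader {𝓑 : Finset (S → A)} {𝓧 : Finset S} (h𝓧 : 𝓧.Nonempty)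
    {O : Multiset (CSCExample S A) → 𝓑} (hO : IsCSCOracle O) {N K : ℕ} (hK : 1 ≤ K)
    (D : Fin N → Fin K → CSCExample S A) (s : Finset (Fin N)) (η : ℝ) {ℓ : 𝓧 → A → ℝ}
    (hℓ : NoTies (restrictPolicy 𝓑 𝓧) (1 / η) (∑ i ∈ s, lossVector 𝓑 (toExamples (D i))) ℓ) :
    oneHot (O (∑ i ∈ s, toExamples (D i) + perturbationSet 𝓧 ((K : ℝ) / η) ℓ)) =
      leader (restrictPolicy 𝓑 𝓧) (1 / η) (∑ i ∈ s, lossVector 𝓑 (toExamples (D i))) ℓ := by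
  refine (hℓ.leader_eq_oneHot fun h' => ?_).symm
  have h := hO (∑ i ∈ s, toExamples (D i) + perturbationSet 𝓧 ((K : ℝ) / η) ℓ) h'
  rw [empCost_past_add_perturbationSet hK, empCost_past_add_perturbationSet hK] at h
  refine le_of_mul_le_mul_left h (div_pos (by exact_mod_cast hK) ?_)
  have h1 : Multiset.card (perturbationSet 𝓧 ((K : ℝ) / η) ℓ) = 𝓧.card := by
    rw [perturbationSet, Multiset.card_map]
    exact Fintype.card_coe 𝓧
  rw [Multiset.card_add, h1]
  exact_mod_cast Nat.add_pos_right _ h𝓧.card_pos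

/-- The function of a policy that reads off a sign from its action at a state. -/
def signAt {𝓑 : Finset (S → A)} (p : (A → Bool) × S) (h : 𝓑) : ℝ :=
  if p.1 (h.1 p.2) then 1 else -1

theorem abs_signAt_le {𝓑 : Finset (S → A)} (p : (A → Bool) × S) (h : 𝓑) : |signAt p h| ≤ 1 := by
  unfold signAt; split_ifs <;> simp

/-- The extreme points of the box of cost vectors are the sign vectors. -/
theorem exists_sum_mul_le_signAt [Fintype A] {𝓑 : Finset (S → A)} {μ : ℝ} {c : A → ℝ}
    (hc : ∀ a, |c a| ≤ μ) (x : S) (d : 𝓑 → ℝ) :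
    ∃ σ : A → Bool, ∑ h : 𝓑, c (h.1 x) * d h ≤ μ * ∑ h : 𝓑, signAt (σ, x) h * d h := by
  classical
  set m : A → ℝ := fun a => ∑ h : 𝓑 with h.1 x = a, d h with hm
  have hfib (f : A → ℝ) : ∑ h : 𝓑, f (h.1 x) * d h = ∑ a, f a * m a := by
    rw [← Finset.sum_fiberwise _ (fun h : 𝓑 => h.1 x)]
    refine Finset.sum_congr rfl fun a _ => ?_
    rw [hm, Finset.mul_sum]
    exact Finset.sum_congr rfl fun h hh => by rw [(Finset.mem_filter.mp hh).2]
  refine ⟨fun a => decide (0 ≤ m a), ?_⟩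
  rw [hfib c]
  simp only [signAt]
  rw [hfib fun a => if decide (0 ≤ m a) = true then 1 else -1, Finset.mul_sum]
  refine Finset.sum_le_sum fun a _ => ?_
  have h1 : (if decide (0 ≤ m a) = true then (1 : ℝ) else -1) * m a = |m a| := by
    by_cases h : 0 ≤ m a
    · simp [h, abs_of_nonneg]
    · simp [h, abs_of_neg (not_le.mp h)]
  rw [h1]
  calc c a * m a ≤ |c a * m a| := le_abs_self _
    _ = |c a| * |m a| := abs_mul _ _
    _ ≤ μ * |m a| := mul_le_mul_of_nonneg_right (hc a) (abs_nonneg _)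

/-- Loss vectors of data sets are averages of cost vectors read off at single states, so they are
controlled by the functions `signAt`, whose number does not involve `𝓑.card`. -/
theorem lossVector_dotProduct_le [Fintype A] {𝓑 : Finset (S → A)} {K : ℕ} (hK : 1 ≤ K) {μ : ℝ}
    (hμ : 0 ≤ μ) {D : Fin K → CSCExample S A} (hD : ∀ k a, |(D k).2 a| ≤ μ) {d : 𝓑 → ℝ} {ε : ℝ}
    (hd : ∀ p : (A → Bool) × S, ∑ h : 𝓑, signAt p h * d h ≤ ε) :
    lossVector 𝓑 (toExamples D) ⬝ᵥ d ≤ μ * ε := by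
  have hK' : (0 : ℝ) < K := by exact_mod_cast hK
  have h1 : lossVector 𝓑 (toExamples D) ⬝ᵥ d =
      (∑ k, ∑ h : 𝓑, (D k).2 (h.1 (D k).1) * d h) / K := by
    simp only [dotProduct, lossVector_toExamples]
    rw [Finset.sum_comm, Finset.sum_div]
    refine Finset.sum_congr rfl fun h _ => ?_
    rw [← Finset.sum_mul]
    ring
  rw [h1, div_le_iff₀ hK']
  calc _ ≤ ∑ k : Fin K, μ * ε := by
        refine Finset.sum_le_sum fun k _ => ?_
        obtain ⟨σ, hσ⟩ := exists_sum_mul_le_signAt (hD k) (D k).1 d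
        exact hσ.trans (mul_le_mul_of_nonneg_left (hd _) hμ)
    _ = _ := by simp [mul_comm]

/-- On good draws, the algorithm pays little more than the law of the perturbed leader. -/
theorem lossVector_dotProduct_mftplRound_le [Fintype A] {𝓑 : Finset (S → A)} {𝓧 : Finset S}
    (h𝓧 : 𝓧.Nonempty) {O : Multiset (CSCExample S A) → 𝓑} (hO : IsCSCOracle O) {N K T : ℕ}
    (hK : 1 ≤ K) (hT : 0 < T) {μ : ℝ} (hμ : 0 ≤ μ) {D : Fin N → Fin K → CSCExample S A}
    {n : Fin N} (hD : ∀ k a, |(D n k).2 a| ≤ μ) {η ε : ℝ} {L : Fin T → 𝓧 → A → ℝ}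
    (hL : GoodDraws (restrictPolicy 𝓑 𝓧) (1 / η) (signAt : (A → Bool) × S → 𝓑 → ℝ) ε
      (∑ i ∈ Finset.Iio n, lossVector 𝓑 (toExamples (D i))) L) :
    lossVector 𝓑 (toExamples (D n)) ⬝ᵥ mftplRound O 𝓧 η D n L ≤
      lossVector 𝓑 (toExamples (D n)) ⬝ᵥ leaderProb (restrictPolicy 𝓑 𝓧) (1 / η)
        (∑ i ∈ Finset.Iio n, lossVector 𝓑 (toExamples (D i))) + μ * ε := by
  have hT' : (0 : ℝ) < T := by exact_mod_cast hT
  rw [← sub_le_iff_le_add', ← dotProduct_sub]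
  refine lossVector_dotProduct_le hK hμ hD fun p => ?_
  have hdev := (hL.2 p).le
  rw [← div_le_iff₀' hT'] at hdev
  refine Eq.trans_le ?_ hdev
  have hu : mftplRound O 𝓧 η D n L = (T : ℝ)⁻¹ • ∑ j, leader (restrictPolicy 𝓑 𝓧) (1 / η)
      (∑ i ∈ Finset.Iio n, lossVector 𝓑 (toExamples (D i))) (L j) := by
    unfold mftplRound mftpl
    congr 1
    exact Finset.sum_congr rfl fun j _ => hO.oneHot_eq_leader h𝓧 hK D _ η (hL.1 j)
  rw [hu, leaderDeviation, Finset.sum_comm, Finset.sum_div]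
  refine Finset.sum_congr rfl fun h _ => ?_
  simp only [Pi.sub_apply, Pi.smul_apply, Finset.sum_apply, smul_eq_mul, ← Finset.mul_sum,
    Finset.sum_sub_distrib, Finset.sum_const, Finset.card_univ, Fintype.card_fin, nsmul_eq_mul]
  field_simp

theorem measurable_lossVector [Finite S] [MeasurableSpace S] [DiscreteMeasurableSpace S]
    (𝓑 : Finset (S → A)) (K : ℕ) :
    Measurable fun D : Fin K → CSCExample S A => lossVector 𝓑 (toExamples D) := by
  refine measurable_pi_lambda _ fun h => ?_
  simp only [lossVector_toExamples]
  have hcost : Measurable fun e : CSCExample S A => e.2 (h.1 e.1) :=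
    measurable_from_prod_countable_right fun s => measurable_pi_apply (h.1 s)
  exact (Finset.measurable_sum _ fun k _ => hcost.comp (measurable_pi_apply k)).div_const _

end Oracle

/-! ### The regret bound -/

/-- The failure probability of one round: there are `2 ^ A * S` functions `signAt`. -/
theorem sign_union_bound {A S N T δ ε Λ : ℝ} {a : ℕ} (hA : A = a) (ha : 1 ≤ a) (hS : 1 ≤ S)
    (hN : 1 ≤ N) (hδ : 0 < δ) (hδ1 : δ ≤ 1) (hΛ : Λ = Real.log (2 * N * S / δ))
    (hε : T * ε ^ 2 / 2 = A * Λ) : 2 ^ a * S * Real.exp (-(T * ε ^ 2 / 2)) ≤ δ / N := by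
  subst hA
  have hpos : 0 < 2 * N * S / δ := by positivity
  have h1 : Real.exp (-(T * ε ^ 2 / 2)) = (δ / (2 * N * S)) ^ a := by
    rw [hε, hΛ, ← mul_neg, ← Real.log_inv, inv_div, Real.exp_nat_mul, Real.exp_log (by positivity)]
  have h2 : (2 * (δ / (2 * N * S))) ^ a ≤ 2 * (δ / (2 * N * S)) := by
    refine pow_le_of_le_one (by positivity) ?_ (by omega)
    rw [← mul_div_assoc, div_le_one (by positivity)]
    nlinarith
  calc 2 ^ a * S * Real.exp (-(T * ε ^ 2 / 2)) = S * (2 * (δ / (2 * N * S))) ^ a := by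
        rw [h1, mul_pow]; ring
    _ ≤ S * (2 * (δ / (2 * N * S))) := by gcongr
    _ = δ / N := by field_simp

/-- The value of the regret bounds at the parameters, in terms of `w = (log B / X) ^ (1 / 4)`, for
which `log B = w ^ 4 * X` and `(X ^ 3 * log B) ^ (1 / 4) = w * X`. The three summands are the range
of the potential, the instability of the leader, and the sampling error. -/
theorem regret_bound_le {N A X μ w Λ T : ℝ} (hN : 1 ≤ N) (hA : 1 ≤ A) (hX : 0 < X) (hμ : 0 < μ)
    (hw : 0 < w) (hwA : w ≤ A) (hΛ : 0 < Λ) (hT : N * Λ / (w * X) ^ 2 ≤ T) :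
    μ * √(N * A) / w * (w ^ 4 * X / w ^ 2 + w ^ 2 * X / 2) +
      N * (2 * μ * ((2 * w / √(N * A)) ^ 2 * X / 2 + 2 * w / √(N * A) * (X * A))) +
      N * (μ * √(2 * A * Λ / T)) ≤ 11 * (μ * √(N * A) * (w * X)) := by
  set m := √(N * A) with hm
  have hNA : 1 ≤ N * A := one_le_mul_of_one_le_of_one_le hN hA
  have hm2 : m ^ 2 = N * A := Real.sq_sqrt (by positivity)
  have hm1 : 1 ≤ m := Real.one_le_sqrt.mpr hNA
  have hm0 : 0 < m := by positivity
  have hT0 : 0 < T := lt_of_lt_of_le (by positivity) hT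
  have h1 : μ * m / w * (w ^ 4 * X / w ^ 2 + w ^ 2 * X / 2) = 3 / 2 * (μ * m * (w * X)) := by
    field_simp
    ring
  have h2 : N * (2 * μ * ((2 * w / m) ^ 2 * X / 2 + 2 * w / m * (X * A))) ≤
      8 * (μ * m * (w * X)) := by
    have ht : 2 * w / m ≤ 2 * A := by
      rw [div_le_iff₀ hm0]
      nlinarith
    have ht0 : 0 ≤ 2 * w / m := by positivity
    calc N * (2 * μ * ((2 * w / m) ^ 2 * X / 2 + 2 * w / m * (X * A)))
        = N * (2 * μ * (2 * w / m * X * (2 * w / m / 2 + A))) := by ring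
      _ ≤ N * (2 * μ * (2 * w / m * X * (2 * A / 2 + A))) := by gcongr
      _ = 8 * μ * w * X * (N * A) / m := by ring
      _ = 8 * (μ * m * (w * X)) := by
          rw [← hm2]
          field_simp
  have h3 : N * (μ * √(2 * A * Λ / T)) ≤ 3 / 2 * (μ * m * (w * X)) := by
    have : N * √(2 * A * Λ / T) ≤ 3 / 2 * (m * (w * X)) := by
      refine abs_le_of_sq_le_sq' ?_ (by positivity) |>.2
      rw [mul_pow, Real.sq_sqrt (by positivity), mul_pow, mul_pow, hm2]
      rw [div_le_iff₀ (by positivity)] at hT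
      rw [← mul_div_assoc, div_le_iff₀ hT0]
      have := mul_le_mul_of_nonneg_left hT (show 0 ≤ 2 * A * N by positivity)
      have : 0 ≤ N * A * (T * (w * X) ^ 2) := by positivity
      nlinarith
    calc N * (μ * √(2 * A * Λ / T)) = μ * (N * √(2 * A * Λ / T)) := by ring
      _ ≤ μ * (3 / 2 * (m * (w * X))) := by gcongr
      _ = _ := by ring
  linarith

/-- Policies are determined by their restrictions to a separator set, so there are at most
`A ^ X`. -/
theorem log_card_le {S A : Type*} [Fintype A] {𝓑 : Finset (S → A)} {𝓧 : Finset S}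
    (hsep : IsSeparator 𝓧 𝓑) (h𝓑 : 0 < 𝓑.card) :
    Real.log 𝓑.card ≤ 𝓧.card * Fintype.card A := by
  classical
  have h1 : 𝓑.card ≤ Fintype.card A ^ 𝓧.card := by
    simpa using Fintype.card_le_of_injective _ hsep.injective_restrictPolicy
  calc Real.log 𝓑.card ≤ Real.log ((Fintype.card A : ℝ) ^ 𝓧.card) :=
        Real.log_le_log (by exact_mod_cast h𝓑) (by exact_mod_cast h1)
    _ = 𝓧.card * Real.log (Fintype.card A) := Real.log_pow _ _
    _ ≤ _ := by
        gcongr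
        exact Real.log_le_self (by positivity)

theorem lemma2 :
    ∃ C : ℝ, 0 < C ∧
      ∀ (S A : Type*) [Fintype S] [Fintype A] [MeasurableSpace S] [DiscreteMeasurableSpace S]
        (𝓑 : Finset (S → A)) (𝓧 : Finset S) (O : Multiset (CSCExample S A) → 𝓑)
        (N K : ℕ) (μ δ η : ℝ) (T : ℕ),
        2 ≤ 𝓑.card → IsSeparator 𝓧 𝓑 → IsCSCOracle O →
        1 ≤ N → 1 ≤ K → 0 < μ → 0 < δ → δ ≤ 1 →
        η = 1 / (μ * √((N : ℝ) * Fintype.card A)) *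
              (Real.log 𝓑.card / 𝓧.card) ^ (1 / 4 : ℝ) →
        T = ⌈(N : ℝ) * Real.log (2 * N * Fintype.card S / δ) /
              √((𝓧.card : ℝ) ^ 3 * Real.log 𝓑.card)⌉₊ →
        ∀ (Ω : Type*) [MeasurableSpace Ω] (P : Measure Ω) [IsProbabilityMeasure P]
          -- `D n ω` is the data set that is revealed after round `n`; `ℓ n ω` holds the
          -- perturbations that the algorithm draws in round `n`
          (D : Fin N → Ω → Fin K → CSCExample S A) (ℓ : Fin N → Ω → Fin T → 𝓧 → A → ℝ),
          (∀ n, AEMeasurable (D n) P) →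
          (∀ n ω k a, |(D n ω k).2 a| ≤ μ) →
          (∀ n, HasLaw (ℓ n) (perturbationLaw A 𝓧 T) P) →
          -- the draws of round `n` are independent of the data sets of the earlier rounds
          (∀ n, IndepFun (fun ω (i : Set.Iio n) => D i ω) (ℓ n) P) →
          P {ω | C * (μ * √((N : ℝ) * Fintype.card A) *
                  ((𝓧.card : ℝ) ^ 3 * Real.log 𝓑.card) ^ (1 / 4 : ℝ)) <
                linearRegret (fun n => lossVector 𝓑 (toExamples (D n ω)))
                  (fun n => mftplRound O 𝓧 η (fun i => D i ω) n (ℓ n ω))} ≤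
            ENNReal.ofReal δ := by
  -- The sum of the constants 3/2, 8 and 3/2 of `regret_bound_le`.
  refine ⟨11, by norm_num, ?_⟩
  intro S A _ _ _ _ 𝓑 𝓧 O N K μ δ η T hB hsep hO hN hK hμ hδ hδ1 hη hT Ω _ P _ D ℓ hDm hDb
    hlaw hind
  classical
  obtain ⟨f₀, hf₀, f₁, hf₁, hne⟩ := Finset.one_lt_card.mp hB
  obtain ⟨x₀, hx₀, hx₀ne⟩ := hsep f₀ hf₀ f₁ hf₁ hne
  have : Nonempty 𝓑 := ⟨⟨f₀, hf₀⟩⟩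
  have h𝓧 : 𝓧.Nonempty := ⟨x₀, hx₀⟩
  have hA1 : 1 ≤ Fintype.card A := Fintype.card_pos_iff.mpr ⟨f₀ x₀⟩
  have hS1 : 1 ≤ Fintype.card S := Fintype.card_pos_iff.mpr ⟨x₀⟩
  have hNR : (1 : ℝ) ≤ N := by exact_mod_cast hN
  have hAR : (1 : ℝ) ≤ Fintype.card A := by exact_mod_cast hA1
  have hSR : (1 : ℝ) ≤ Fintype.card S := by exact_mod_cast hS1
  have hX : (0 : ℝ) < 𝓧.card := by exact_mod_cast h𝓧.card_pos
  have hlB : 0 < Real.log 𝓑.card := Real.log_pos (by exact_mod_cast hB)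
  set w : ℝ := (Real.log 𝓑.card / 𝓧.card) ^ (1 / 4 : ℝ) with hw
  have hw0 : 0 < w := by positivity
  have hw4 : w ^ 4 * 𝓧.card = Real.log 𝓑.card := by
    rw [hw, ← Real.rpow_natCast, ← Real.rpow_mul (by positivity)]
    norm_num
    field_simp
  have hwA : w ≤ Fintype.card A := by
    have h1 : w ^ 4 ≤ Fintype.card A := by
      have := log_card_le hsep (by omega)
      rw [← hw4, mul_comm (𝓧.card : ℝ)] at this
      exact le_of_mul_le_mul_right this hX
    refine le_of_pow_le_pow_left₀ (n := 4) (by norm_num) (by positivity) (h1.trans ?_)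
    exact le_self_pow₀ hAR (by norm_num)
  have hQ : (𝓧.card : ℝ) ^ 3 * Real.log 𝓑.card = (w * 𝓧.card) ^ 4 := by rw [← hw4]; ring
  have hQ4 : ((𝓧.card : ℝ) ^ 3 * Real.log 𝓑.card) ^ (1 / 4 : ℝ) = w * 𝓧.card := by
    rw [hQ, ← Real.rpow_natCast, ← Real.rpow_mul (by positivity)]
    norm_num
  have hQ2 : √((𝓧.card : ℝ) ^ 3 * Real.log 𝓑.card) = (w * 𝓧.card) ^ 2 := by
    rw [hQ, show (w * 𝓧.card) ^ 4 = ((w * 𝓧.card) ^ 2) ^ 2 by ring, Real.sqrt_sq (by positivity)]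
  rw [hQ4]
  rw [hQ2] at hT
  set Λ : ℝ := Real.log (2 * N * Fintype.card S / δ) with hΛ
  have hΛ0 : 0 < Λ := by
    refine Real.log_pos ?_
    rw [lt_div_iff₀ hδ]
    nlinarith
  have hTle : N * Λ / (w * 𝓧.card) ^ 2 ≤ T := by rw [hT]; exact Nat.le_ceil _
  have hT0 : (0 : ℝ) < T := lt_of_lt_of_le (by positivity) hTle
  set ε : ℝ := √(2 * Fintype.card A * Λ / T) with hε
  have hTε : T * ε ^ 2 / 2 = Fintype.card A * Λ := by
    rw [hε, Real.sq_sqrt (by positivity)]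
    field_simp
  set m : ℝ := √((N : ℝ) * Fintype.card A) with hm
  have hm0 : 0 < m := by positivity
  have hη0 : 0 < η := by rw [hη]; positivity
  have hr : 1 / η = μ * m / w := by rw [hη]; field_simp
  set pol := restrictPolicy 𝓑 𝓧
  have hpol : Function.Injective pol := hsep.injective_restrictPolicy
  set g : Fin N → Ω → 𝓑 → ℝ := fun n ω => lossVector 𝓑 (toExamples (D n ω)) with hg
  set G : Fin N → Ω → 𝓑 → ℝ := fun n ω => ∑ i ∈ Finset.Iio n, g i ω with hG
  set F : (A → Bool) × S → 𝓑 → ℝ := signAt with hF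
  have hbad (n : Fin N) :
      P {ω | ¬ GoodDraws pol (1 / η) F ε (G n ω) (ℓ n ω)} ≤ ENNReal.ofReal (δ / N) := by
    have hGm : AEMeasurable (G n) P :=
      Finset.aemeasurable_fun_sum _ fun i _ =>
        (measurable_lossVector 𝓑 K).comp_aemeasurable (hDm i)
    have hGi : IndepFun (G n) (ℓ n) P := by
      have hφ : Measurable fun d : Set.Iio n → Fin K → CSCExample S A =>
          ∑ i : Set.Iio n, lossVector 𝓑 (toExamples (d i)) :=
        Finset.measurable_fun_sum _ fun i _ =>
          (measurable_lossVector 𝓑 K).comp (measurable_pi_apply i)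
      have := (hind n).comp hφ measurable_id
      rw [Function.id_comp] at this
      convert this using 1
      ext1 ω
      simp only [hG, hg, Function.comp_apply]
      exact Finset.sum_subtype _ (by simp) _
    refine (measure_not_goodDraws_comp_le hpol (by positivity) (fun p h => abs_signAt_le p h)
      (ε := ε) (Real.sqrt_nonneg _) hGm (hlaw n) hGi).trans ?_
    rw [← ENNReal.ofReal_natCast, ← ENNReal.ofReal_mul (by positivity)]
    refine ENNReal.ofReal_le_ofReal ?_
    have := sign_union_bound rfl hA1 hSR hNR hδ hδ1 hΛ hTε
    rw [Fintype.card_prod, Fintype.card_fun, Fintype.card_bool]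
    exact_mod_cast this
  have hgood (ω : Ω) (hω : ∀ n, GoodDraws pol (1 / η) F ε (G n ω) (ℓ n ω)) :
      linearRegret (fun n => g n ω)
        (fun n => mftplRound O 𝓧 η (fun i => D i ω) n (ℓ n ω)) ≤
        11 * (μ * m * (w * 𝓧.card)) := by
    unfold linearRegret
    rw [sub_le_comm]
    refine le_ciInf fun v => ?_
    rw [sub_le_comm]
    have h1 : ∑ n, g n ω ⬝ᵥ mftplRound O 𝓧 η (fun i => D i ω) n (ℓ n ω) ≤
        ∑ n, (g n ω ⬝ᵥ leaderProb pol (1 / η) (G n ω) + μ * ε) :=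
      Finset.sum_le_sum fun n _ => lossVector_dotProduct_mftplRound_le h𝓧 hO hK
        (by exact_mod_cast hT0) hμ.le (D := fun i => D i ω) (fun k a => hDb n ω k a) (hω n)
    have h2 := leaderProb_regret_le hpol (r := 1 / η) (by positivity) (g := fun n => g n ω)
      (fun n h => abs_lossVector_le hK (hDb n ω) h) (t := 2 * w / m) (by positivity)
      (by rw [hr]; exact le_of_eq (by field_simp)) (s := w ^ 2) (by positivity) v.2
    have h3 := regret_bound_le hNR hAR hX hμ hw0 hwA hΛ0 hTle
    rw [Finset.sum_add_distrib] at h1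
    simp only [Finset.sum_const, Finset.card_univ, Fintype.card_fin, nsmul_eq_mul] at h1
    rw [hr] at h1 h2
    simp only [Fintype.card_coe, ← hw4] at h2
    linarith
  calc P {ω | 11 * (μ * m * (w * 𝓧.card)) < linearRegret (fun n => g n ω)
        (fun n => mftplRound O 𝓧 η (fun i => D i ω) n (ℓ n ω))}
      ≤ P (⋃ n, {ω | ¬ GoodDraws pol (1 / η) F ε (G n ω) (ℓ n ω)}) := by
        refine measure_mono fun ω hω => ?_
        by_contra hc
        simp only [Set.mem_iUnion, Set.mem_ofPred_eq, not_exists, not_not] at hc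
        exact absurd (hgood ω hc) (not_le.mpr hω)
    _ ≤ ∑ n : Fin N, ENNReal.ofReal (δ / N) :=
        (measure_iUnion_fintype_le _ _).trans (Finset.sum_le_sum fun n _ => hbad n)
    _ = ENNReal.ofReal δ := by
        rw [Finset.sum_const, Finset.card_univ, Fintype.card_fin, nsmul_eq_mul,
          ← ENNReal.ofReal_natCast, ← ENNReal.ofReal_mul (by positivity)]
        congr 1
        field_simp
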